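/- For a complex matrix $M$ put $\Re(M)=\tfrac12(M+M^*)$ and $|M|=(M^*M)^{1/2}$. Call a square matrix $M$ accretive if $\Re(M)$ is positive semidefinite, and strictly accretive if $\Re(M)$ is positive definite. A $2\times2$ block matrix $\begin{bmatrix}P&Q\\R&S\end{bmatrix}$ with $n\times n$ blocks is called accretive partial transpose (APT) if both it and its partial transpose $\begin{bmatrix}P&R\\Q&S\end{bmatrix}$ are accretive. For strictly accretive $A,B$ and $t\in[0,1]$ let $A\sharp_tB=A^{1/2}\big(A^{-1/2}BA^{-1/2}\big)^tA^{1/2}$, where the powers are given by the holomorphic functional calculus for the principal branch of $z\mapsto z^r$ on $\mathbb{C}\setminus(-\infty,0]$. For a Hermitian $n\times n$ matrix $H$ let $\lambda_1(H)\ge\dots\ge\lambda_n(H)$ be its eigenvalues counted with multiplicity, and let $s_j(M)=\lambda_j(|M|)$ be the singular values of an $n\times n$ matrix $M$. Let $A,B,X$ be complex $n\times n$ matrices such that $A$ and $B$ are strictly accretive and $\begin{bmatrix}A&X\\X^*&B\end{bmatrix}$ is APT. Then for every $t\in[0,1]$ and every $j=1,\dots,n$, $$\lambda_j\big(2|X|-\Re(A\sharp_tB)\big)\;\le\;\lambda_j\big(\Re(A\sharp_{1-t}B)\big)\;\le\;s_j\big(A\sharp_{1-t}B\big).$$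 -/

import Mathlib

open scoped Matrix ComplexOrder MatrixOrder ComplexStarModule

noncomputable section

namespace MatrixMeans

open Polynomial

/-! ### Functions of a (not necessarily normal) complex matrix

The holomorphic functional calculus of a square complex matrix: `f(M) = p(M)` for any polynomial
`p` which agrees with `f` on the spectrum of `M`, to the order of the zeros of the minimal
polynomial. -/

/-- The polynomial `p` agrees with `f` on the spectrum of `M`: for each eigenvalue `μ`, being
a zero of order `m` of the minimal polynomial of `M`, one has `p⁽ᵏ⁾(μ) = f⁽ᵏ⁾(μ)` for `k < m`. -/
def AgreesOnSpectrum {n : ℕ} (p : ℂ[X]) (f : ℂ → ℂ) (M : Matrix (Fin n) (Fin n) ℂ) : Prop :=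
  ∀ μ ∈ spectrum ℂ M, ∀ k < (minpoly ℂ M).rootMultiplicity μ,
    (derivative^[k] p).eval μ = iteratedDeriv k f μ

/-- Polynomials with prescribed jets at the points of a finite set exist. -/
theorem exists_hermite (S : Finset ℂ) (m : ℂ → ℕ) (c : ℂ → ℕ → ℂ) :
    ∃ p : ℂ[X], ∀ μ ∈ S, ∀ k < m μ, (derivative^[k] p).eval μ = c μ k := by
  classical
  let P : ℂ → ℂ[X] := fun μ =>
    ∑ k ∈ Finset.range (m μ), C (c μ k / (k.factorial : ℂ)) * (X - C μ) ^ k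
  obtain ⟨p, hp⟩ := Ideal.exists_forall_sub_mem_ideal (ι := S)
    (I := fun μ => Ideal.span {(X - C (μ : ℂ)) ^ m μ})
    (fun i j hij => by
      refine (Ideal.isCoprime_span_singleton_iff _ _).mpr ?_
      exact (isCoprime_X_sub_C_of_isUnit_sub
        (sub_ne_zero.mpr (fun h => hij (Subtype.ext h))).isUnit).pow)
    (fun μ => P μ)
  refine ⟨p, fun μ hμ k hk => ?_⟩
  obtain ⟨q, hq⟩ := Ideal.mem_span_singleton.mp (hp ⟨μ, hμ⟩)
  have hp' : p = P μ + (X - C μ) ^ m μ * q := by rw [← hq]; ring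
  have h1 : (taylor μ p).coeff k = c μ k / (k.factorial : ℂ) := by
    have h2 : taylor μ (P μ) = ∑ k ∈ Finset.range (m μ), C (c μ k / (k.factorial : ℂ)) * X ^ k := by
      simp [P, map_sum]
    have h3 : taylor μ ((X - C μ) ^ m μ * q) = X ^ m μ * taylor μ q := by
      simp
    rw [hp', map_add, h2, h3, coeff_add, coeff_X_pow_mul', if_neg (by omega)]
    simp [coeff_X_pow, hk]
  rw [taylor_coeff] at h1
  have h4 := congrFun (factorial_smul_hasseDeriv (R := ℂ) k) p
  have h5 : (derivative^[k] p).eval μ = (k.factorial : ℂ) * (hasseDeriv k p).eval μ := by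
    rw [← h4]; simp
  rw [h5, h1]
  field_simp

theorem exists_agreesOnSpectrum {n : ℕ} (f : ℂ → ℂ) (M : Matrix (Fin n) (Fin n) ℂ) :
    ∃ p : ℂ[X], AgreesOnSpectrum p f M := by
  obtain ⟨p, hp⟩ := exists_hermite (minpoly ℂ M).roots.toFinset
    (fun μ => (minpoly ℂ M).rootMultiplicity μ) (fun μ k => iteratedDeriv k f μ)
  refine ⟨p, fun μ _ k hk => hp μ ?_ k hk⟩
  rw [Multiset.mem_toFinset, ← Multiset.count_pos, count_roots]
  omega

/-- The matrix `f(M)`, where `f` is holomorphic near the spectrum of `M`. -/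
def matrixFunction {n : ℕ} (f : ℂ → ℂ) (M : Matrix (Fin n) (Fin n) ℂ) :
    Matrix (Fin n) (Fin n) ℂ :=
  aeval M (exists_agreesOnSpectrum f M).choose

/-- `f(M) = p(M)` for every polynomial `p` that agrees with `f` on the spectrum of `M`. -/
theorem matrixFunction_eq {n : ℕ} {f : ℂ → ℂ} {M : Matrix (Fin n) (Fin n) ℂ} {p : ℂ[X]}
    (hp : AgreesOnSpectrum p f M) : matrixFunction f M = aeval M p := by
  set q := (exists_agreesOnSpectrum f M).choose with hq
  have hq' : AgreesOnSpectrum q f M := (exists_agreesOnSpectrum f M).choose_spec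
  have hM : minpoly ℂ M ≠ 0 := minpoly.ne_zero (Matrix.isIntegral M)
  suffices h : minpoly ℂ M ∣ q - p by
    obtain ⟨r, hr⟩ := h
    have := congrArg (aeval M) hr
    rw [map_mul, minpoly.aeval, zero_mul, map_sub, sub_eq_zero] at this
    exact this
  by_cases h0 : q - p = 0
  · rw [h0]; exact dvd_zero _
  refine (IsAlgClosed.splits (minpoly ℂ M)).dvd_of_roots_le_roots hM ?_
  rw [Multiset.le_iff_count]
  intro μ
  rw [count_roots, count_roots]
  by_contra! hlt
  have hroot : (minpoly ℂ M).IsRoot μ :=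
    (rootMultiplicity_pos hM).mp (lt_of_le_of_lt (Nat.zero_le _) hlt)
  have hμ : μ ∈ spectrum ℂ M := by
    rw [← AlgEquiv.spectrum_eq (Matrix.toLinAlgEquiv' (R := ℂ) (n := Fin n)) M,
      ← Module.End.hasEigenvalue_iff_mem_spectrum]
    apply Module.End.hasEigenvalue_of_isRoot
    rwa [minpoly.algEquiv_eq]
  refine absurd ((lt_rootMultiplicity_iff_isRoot_iterate_derivative h0
    (n := (q - p).rootMultiplicity μ) (t := μ)).mpr fun k hk => ?_) (lt_irrefl _)
  have hk' := lt_of_le_of_lt hk hlt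
  simp [IsRoot, hq' μ hμ k hk', hp μ hμ k hk']

/-- The fractional power `M ^ r`, by the principal branch of `z ↦ z ^ r`. It is meaningful when
no eigenvalue of `M` lies in `(-∞, 0]`. -/
def mpow {n : ℕ} (M : Matrix (Fin n) (Fin n) ℂ) (r : ℝ) : Matrix (Fin n) (Fin n) ℂ :=
  matrixFunction (fun z => z ^ (r : ℂ)) M

/-- The weighted geometric mean `A ♯ₜ B = A^{1/2} (A^{-1/2} B A^{-1/2})^t A^{1/2}`. -/
def geomMean {n : ℕ} (t : ℝ) (A B : Matrix (Fin n) (Fin n) ℂ) : Matrix (Fin n) (Fin n) ℂ :=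
  mpow A (1 / 2) * mpow (mpow A (-(1 / 2)) * B * mpow A (-(1 / 2))) t * mpow A (1 / 2)

/-! ### Accretive matrices and accretive partial transpose -/

/-- `M` is accretive: its real part `(M + Mᴴ) / 2` is positive semidefinite. -/
def IsAccretive {ι : Type*} [Fintype ι] (M : Matrix ι ι ℂ) : Prop :=
  ((ℜ M : selfAdjoint (Matrix ι ι ℂ)) : Matrix ι ι ℂ).PosSemidef

/-- `M` is strictly accretive: its real part `(M + Mᴴ) / 2` is positive definite. -/
def IsStrictlyAccretive {ι : Type*} [Fintype ι] (M : Matrix ι ι ℂ) : Prop :=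
  ((ℜ M : selfAdjoint (Matrix ι ι ℂ)) : Matrix ι ι ℂ).PosDef

/-- The partial transpose of a `2 × 2` block matrix: the off-diagonal blocks are swapped. -/
def partialTranspose {ι : Type*} (M : Matrix (ι ⊕ ι) (ι ⊕ ι) ℂ) : Matrix (ι ⊕ ι) (ι ⊕ ι) ℂ :=
  Matrix.fromBlocks M.toBlocks₁₁ M.toBlocks₂₁ M.toBlocks₁₂ M.toBlocks₂₂

/-- `M` is accretive partial transpose (APT). -/
def IsAPT {ι : Type*} [Fintype ι] (M : Matrix (ι ⊕ ι) (ι ⊕ ι) ℂ) : Prop :=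
  IsAccretive M ∧ IsAccretive (partialTranspose M)

/-! ### Eigenvalues and singular values -/

/-- The `j`-th eigenvalue of a Hermitian matrix, in decreasing order with multiplicity
(indices start at `0`). -/
def lam {n : ℕ} (H : Matrix (Fin n) (Fin n) ℂ) (hH : H.IsHermitian) (j : Fin n) : ℝ :=
  hH.eigenvalues₀ (Fin.cast (Fintype.card_fin n).symm j)

theorem isHermitian_abs {n : ℕ} (M : Matrix (Fin n) (Fin n) ℂ) : (CFC.abs M).IsHermitian :=
  (Matrix.nonneg_iff_posSemidef.mp (CFC.abs_nonneg M)).isHermitian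

theorem isHermitian_realPart {n : ℕ} (M : Matrix (Fin n) (Fin n) ℂ) :
    (ℜ M : Matrix (Fin n) (Fin n) ℂ).IsHermitian :=
  (ℜ M).2

theorem isHermitian_two_abs_sub {n : ℕ} (X M : Matrix (Fin n) (Fin n) ℂ) :
    ((2 : ℝ) • CFC.abs X - (ℜ M : Matrix (Fin n) (Fin n) ℂ)).IsHermitian := by
  refine Matrix.IsHermitian.sub ?_ (isHermitian_realPart M)
  rw [two_smul]
  exact (isHermitian_abs X).add (isHermitian_abs X)

/-- The `j`-th singular value of `M`: the `j`-th eigenvalue of `|M| = (Mᴴ M)^{1/2}`. -/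
def sval {n : ℕ} (M : Matrix (Fin n) (Fin n) ℂ) (j : Fin n) : ℝ :=
  lam (CFC.abs M) (isHermitian_abs M) j

end MatrixMeans

end

open scoped Matrix ComplexOrder MatrixOrder ComplexStarModule

noncomputable section

namespace MatrixMeans

open Matrix

/-! Everything is done with the real quadratic forms M[x] = Re x*Mx, which depend only on the real
part of M. Applied to vectors (u, -v), the APT condition bounds 2 Re u*Xv by A[u] + B[v] and,
through the partial transpose, by B[u] + A[v].

The core is the interpolated bound 2 Re u*Xv ≤ (A ♯ₜ B)[u] + (A ♯₁₋ₜ B)[v]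
(`two_mul_re_le_rform_geomMean`). A congruence turns Re A into 1 and Re B into a diagonal D > 0, and
X into a matrix Y with Y D⁻¹ Y* ≤ 1 and Y Y* ≤ D. Interpolation gives Y D^(t-1) Y* ≤ D^t, hence the
bound with Re A ♯ₜ Re B and Re A ♯₁₋ₜ Re B on the right (`two_mul_re_le_sum_rpow`). It remains to
use Re A ♯ₜ Re B ≤ Re (A ♯ₜ B) (`sum_rpow_le_rform_geomMean`). Both inequalities come from writing
x^t, up to a constant, as ∫ s^(t-1) x/(s+x) ds over s > 0, and comparing integrands by the convexity
of |z|²/p.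

With a polar decomposition X = U|X|, the choice u = Ux, v = x and weights 1-t, t gives 2|X| - Re (A
♯ₜ B) ≤ U* Re (A ♯₁₋ₜ B) U. Comparison of eigenvalues by a dimension count yields the first claim;
the second is the Fan–Hoffman inequality. -/

/-- The real part of the quadratic form `x ↦ x* M x`. -/
def rform {ι : Type*} [Fintype ι] (M : Matrix ι ι ℂ) (x : ι → ℂ) : ℝ :=
  (star x ⬝ᵥ M *ᵥ x).re

/-- The squared Euclidean norm of a complex vector. -/
def nsq {ι : Type*} [Fintype ι] (x : ι → ℂ) : ℝ := ∑ i, Complex.normSq (x i)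

/-! ### Quadratic forms of complex matrices -/

section Forms

variable {ι : Type*} [Fintype ι]

theorem star_dotProduct_self_re (x : ι → ℂ) : (star x ⬝ᵥ x).re = nsq x := by
  simp [dotProduct, nsq, Complex.normSq_apply]

theorem star_dotProduct_mulVec (M : Matrix ι ι ℂ) (x y : ι → ℂ) :
    star x ⬝ᵥ M *ᵥ y = star (Mᴴ *ᵥ x) ⬝ᵥ y := by
  rw [star_mulVec, conjTranspose_conjTranspose, dotProduct_mulVec]

theorem re_star_dotProduct_comm (x y : ι → ℂ) : (star x ⬝ᵥ y).re = (star y ⬝ᵥ x).re := by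
  simp only [dotProduct, Complex.re_sum]
  refine Finset.sum_congr rfl fun i _ => ?_
  simp [Complex.mul_re]
  ring

theorem rform_conjTranspose (M : Matrix ι ι ℂ) (x : ι → ℂ) : rform Mᴴ x = rform M x := by
  rw [rform, rform, star_dotProduct_mulVec, conjTranspose_conjTranspose, re_star_dotProduct_comm]

theorem rform_add (M N : Matrix ι ι ℂ) (x : ι → ℂ) : rform (M + N) x = rform M x + rform N x := by
  simp [rform, add_mulVec]

theorem rform_sub (M N : Matrix ι ι ℂ) (x : ι → ℂ) : rform (M - N) x = rform M x - rform N x := by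
  simp [rform, sub_mulVec]

theorem rform_smul (r : ℝ) (M : Matrix ι ι ℂ) (x : ι → ℂ) : rform (r • M) x = r * rform M x := by
  simp [rform, smul_mulVec]

theorem rform_realPart (M : Matrix ι ι ℂ) (x : ι → ℂ) :
    rform (ℜ M : Matrix ι ι ℂ) x = rform M x := by
  rw [realPart_apply_coe, star_eq_conjTranspose, rform_smul, rform_add, rform_conjTranspose]
  ring

theorem nsq_nonneg (x : ι → ℂ) : 0 ≤ nsq x := Finset.sum_nonneg fun _ _ => Complex.normSq_nonneg _

theorem nsq_pos {x : ι → ℂ} (hx : x ≠ 0) : 0 < nsq x := by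
  obtain ⟨i, hi⟩ := Function.ne_iff.mp hx
  exact Finset.sum_pos' (fun _ _ => Complex.normSq_nonneg _)
    ⟨i, Finset.mem_univ _, Complex.normSq_pos.mpr hi⟩

theorem nsq_mulVec (M : Matrix ι ι ℂ) (x : ι → ℂ) : nsq (M *ᵥ x) = rform (Mᴴ * M) x := by
  rw [rform, ← mulVec_mulVec, star_dotProduct_mulVec, conjTranspose_conjTranspose,
    star_dotProduct_self_re]

theorem nsq_mulVec_of_isometry [DecidableEq ι] {U : Matrix ι ι ℂ} (hU : Uᴴ * U = 1) (x : ι → ℂ) :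
    nsq (U *ᵥ x) = nsq x := by
  rw [nsq_mulVec, hU, rform, one_mulVec, star_dotProduct_self_re]

theorem rform_conj (M V : Matrix ι ι ℂ) (x : ι → ℂ) :
    rform (V * M * Vᴴ) x = rform M (Vᴴ *ᵥ x) := by
  rw [rform, rform, ← mulVec_mulVec, ← mulVec_mulVec, star_dotProduct_mulVec]

theorem rform_diagonal [DecidableEq ι] (d : ι → ℝ) (x : ι → ℂ) :
    rform (diagonal fun i => (d i : ℂ)) x = ∑ i, d i * Complex.normSq (x i) := by
  simp only [rform, mulVec_diagonal, dotProduct, Complex.re_sum]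
  refine Finset.sum_congr rfl fun i _ => ?_
  simp [Complex.normSq_apply, Complex.mul_re]
  ring

theorem two_mul_re_star_dotProduct_le (x y : ι → ℂ) :
    2 * (star x ⬝ᵥ y).re ≤ nsq x + nsq y := by
  simp only [dotProduct, Complex.re_sum, nsq, Finset.mul_sum, ← Finset.sum_add_distrib]
  refine Finset.sum_le_sum fun i _ => ?_
  simp only [Pi.star_apply, RCLike.star_def, Complex.mul_re, Complex.conj_re, Complex.conj_im,
    Complex.normSq_apply]
  nlinarith [sq_nonneg ((x i).re - (y i).re), sq_nonneg ((x i).im - (y i).im)]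

theorem posSemidef_rform_nonneg {M : Matrix ι ι ℂ} (hM : M.PosSemidef) (x : ι → ℂ) :
    0 ≤ rform M x :=
  (Complex.nonneg_iff.mp (hM.dotProduct_mulVec_nonneg x)).1

theorem posDef_rform_pos {M : Matrix ι ι ℂ} (hM : M.PosDef) {x : ι → ℂ} (hx : x ≠ 0) :
    0 < rform M x :=
  (Complex.pos_iff.mp (hM.dotProduct_mulVec_pos hx)).1

end Forms

/-! ### Ordered eigenvalues, singular values and the polar decomposition -/

section Eigenvalues

variable {n : ℕ}

theorem lam_antitone {H : Matrix (Fin n) (Fin n) ℂ} (hH : H.IsHermitian) : Antitone (lam H hH) :=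
  fun _ _ h => hH.eigenvalues₀_antitone (by simpa using h)

/-- The spectral theorem, with the eigenvalues in decreasing order. -/
theorem exists_unitary_diagonal_lam {H : Matrix (Fin n) (Fin n) ℂ} (hH : H.IsHermitian) :
    ∃ V : Matrix (Fin n) (Fin n) ℂ, Vᴴ * V = 1 ∧ V * Vᴴ = 1 ∧
      H = V * diagonal (fun i => (lam H hH i : ℂ)) * Vᴴ := by
  -- `eigenvalues` is `eigenvalues₀` carried along an arbitrary bijection; `e` undoes that
  -- relabelling, so the order becomes decreasing.
  let e : Fin n ≃ Fin n := (finCongr (Fintype.card_fin n).symm).trans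
    (Fintype.equivOfCardEq (Fintype.card_fin _))
  have he : ∀ i, hH.eigenvalues (e i) = lam H hH i := fun i => by
    simp [IsHermitian.eigenvalues, lam, e]
  let W : Matrix (Fin n) (Fin n) ℂ := hH.eigenvectorUnitary
  have h1 : Wᴴ * W = 1 := (mem_unitaryGroup_iff').mp hH.eigenvectorUnitary.2
  have h2 : W * Wᴴ = 1 := (mem_unitaryGroup_iff).mp hH.eigenvectorUnitary.2
  have h3 : H = W * diagonal (fun i => (hH.eigenvalues i : ℂ)) * Wᴴ := hH.spectral_theorem
  refine ⟨W.submatrix id e, ?_, ?_, ?_⟩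
  · rw [conjTranspose_submatrix, ← submatrix_mul _ _ _ _ _ Function.bijective_id, h1]
    simp
  · rw [conjTranspose_submatrix, submatrix_mul_equiv, h2]
    simp
  · have h4 : diagonal (fun i => (lam H hH i : ℂ)) =
        (diagonal (fun i => (hH.eigenvalues i : ℂ))).submatrix e e := by
      ext i k
      simp [diagonal_apply, he]
    rw [h4, conjTranspose_submatrix, submatrix_mul_equiv, submatrix_mul_equiv, ← h3, submatrix_id_id]

/-- For Hermitian `H`, `K` and an isometry `U`, there is a nonzero vector `x` in the span of the
eigenvectors of `H` to the eigenvalues `λ_i(H)`, `i ≤ j`, such that `U x` is in the span of the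
eigenvectors of `K` to the eigenvalues `λ_i(K)`, `i ≥ j`. -/
theorem exists_ne_zero_lam_le {H K U : Matrix (Fin n) (Fin n) ℂ} (hH : H.IsHermitian)
    (hK : K.IsHermitian) (hU : Uᴴ * U = 1) (j : Fin n) :
    ∃ x : Fin n → ℂ, x ≠ 0 ∧ lam H hH j * nsq x ≤ rform H x ∧
      rform K (U *ᵥ x) ≤ lam K hK j * nsq x ∧
      (K.PosSemidef → nsq (K *ᵥ (U *ᵥ x)) ≤ lam K hK j ^ 2 * nsq x) := by
  obtain ⟨V, hV, hV', hHV⟩ := exists_unitary_diagonal_lam hH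
  obtain ⟨W, hW, hW', hKW⟩ := exists_unitary_diagonal_lam hK
  -- One linear condition for each `i ≠ j`: n - 1 equations in n unknowns, so a nonzero solution
  -- exists.
  let T : Matrix {i : Fin n // i ≠ j} (Fin n) ℂ :=
    of fun i k => if i.1 < j then (Wᴴ * U) i.1 k else Vᴴ i.1 k
  have hker : LinearMap.ker T.mulVecLin ≠ ⊥ := by
    apply LinearMap.ker_ne_bot_of_finrank_lt
    have : 0 < n := j.pos
    simp [Fintype.card_subtype_compl]
    omega
  obtain ⟨x, hx, hx0⟩ := (Submodule.ne_bot_iff _).mp hker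
  have hT : T *ᵥ x = 0 := by simpa using hx
  have hlo : ∀ i, i < j → (Wᴴ *ᵥ (U *ᵥ x)) i = 0 := fun i hi => by
    have := congrFun hT ⟨i, hi.ne⟩
    rw [mulVec_mulVec]
    simpa [T, mulVec, hi] using this
  have hhi : ∀ i, j < i → (Vᴴ *ᵥ x) i = 0 := fun i hi => by
    have := congrFun hT ⟨i, hi.ne'⟩
    simpa [T, mulVec, hi.not_gt] using this
  have hn1 : nsq (Vᴴ *ᵥ x) = nsq x :=
    nsq_mulVec_of_isometry (by rwa [conjTranspose_conjTranspose]) x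
  have hn2 : nsq (Wᴴ *ᵥ (U *ᵥ x)) = nsq x := by
    rw [nsq_mulVec_of_isometry (by rwa [conjTranspose_conjTranspose]), nsq_mulVec_of_isometry hU]
  refine ⟨x, hx0, ?_, ?_, fun hpos => ?_⟩
  · rw [congrArg (rform · x) hHV]
    rw [rform_conj, rform_diagonal, ← hn1, nsq, Finset.mul_sum]
    refine Finset.sum_le_sum fun i _ => ?_
    rcases le_or_gt i j with h | h
    · exact mul_le_mul_of_nonneg_right (lam_antitone hH h) (Complex.normSq_nonneg _)
    · simp [hhi i h]
  · rw [congrArg (rform · (U *ᵥ x)) hKW]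
    rw [rform_conj, rform_diagonal, ← hn2, nsq, Finset.mul_sum]
    refine Finset.sum_le_sum fun i _ => ?_
    rcases lt_or_ge i j with h | h
    · simp [hlo i h]
    · exact mul_le_mul_of_nonneg_right (lam_antitone hK h) (Complex.normSq_nonneg _)
  · have h1 : nsq (K *ᵥ (U *ᵥ x)) =
        ∑ i, lam K hK i ^ 2 * Complex.normSq ((Wᴴ *ᵥ (U *ᵥ x)) i) := by
      rw [congrArg (fun L => nsq (L *ᵥ (U *ᵥ x))) hKW]
      rw [← mulVec_mulVec, ← mulVec_mulVec, nsq_mulVec_of_isometry hW, nsq]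
      simp [mulVec_diagonal, Complex.normSq_mul, sq]
    rw [h1, ← hn2, nsq, Finset.mul_sum]
    refine Finset.sum_le_sum fun i _ => ?_
    rcases lt_or_ge i j with h | h
    · simp [hlo i h]
    · have h0 : 0 ≤ lam K hK i := by
        have := hpos.eigenvalues_nonneg
          ((Fintype.equivOfCardEq (Fintype.card_fin _)) (Fin.cast (Fintype.card_fin n).symm i))
        simpa [IsHermitian.eigenvalues, lam] using this
      exact mul_le_mul_of_nonneg_right (pow_le_pow_left₀ h0 (lam_antitone hK h) 2)
        (Complex.normSq_nonneg _)

/-- At the common vector x of the dimension count, λ_j(H)|x|² ≤ H[x] ≤ K[Ux] ≤ λ_j(K)|x|². -/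
theorem lam_le_lam_of_rform_le {H K U : Matrix (Fin n) (Fin n) ℂ} (hH : H.IsHermitian)
    (hK : K.IsHermitian) (hU : Uᴴ * U = 1) (h : ∀ x, rform H x ≤ rform K (U *ᵥ x)) (j : Fin n) :
    lam H hH j ≤ lam K hK j := by
  obtain ⟨x, hx, h1, h2, -⟩ := exists_ne_zero_lam_le hH hK hU j
  exact le_of_mul_le_mul_right (h1.trans ((h x).trans h2)) (nsq_pos hx)

theorem posSemidef_abs (M : Matrix (Fin n) (Fin n) ℂ) : (CFC.abs M).PosSemidef :=
  Matrix.nonneg_iff_posSemidef.mp (CFC.abs_nonneg M)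

theorem nsq_abs_mulVec (M : Matrix (Fin n) (Fin n) ℂ) (x : Fin n → ℂ) :
    nsq (CFC.abs M *ᵥ x) = nsq (M *ᵥ x) := by
  rw [nsq_mulVec, nsq_mulVec, (isHermitian_abs M).eq, CFC.abs_mul_abs, star_eq_conjTranspose]

/-- The eigenvalues of the real part are bounded by the singular values (Fan and Hoffman). -/
theorem lam_realPart_le_sval (M : Matrix (Fin n) (Fin n) ℂ) (j : Fin n) :
    lam (ℜ M : Matrix (Fin n) (Fin n) ℂ) (isHermitian_realPart M) j ≤ sval M j := by
  obtain ⟨x, hx, h1, -, h2⟩ := exists_ne_zero_lam_le (U := 1) (isHermitian_realPart M)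
    (isHermitian_abs M) (by simp) j
  have h3 := h2 (posSemidef_abs M)
  rw [one_mulVec, nsq_abs_mulVec] at h3
  rw [rform_realPart] at h1
  set l := lam (ℜ M : Matrix (Fin n) (Fin n) ℂ) (isHermitian_realPart M) j
  have hs : 0 ≤ sval M j := by
    have := (posSemidef_abs M).eigenvalues_nonneg
      ((Fintype.equivOfCardEq (Fintype.card_fin _)) (Fin.cast (Fintype.card_fin n).symm j))
    simpa [IsHermitian.eigenvalues, sval, lam] using this
  change nsq (M *ᵥ x) ≤ sval M j ^ 2 * nsq x at h3
  by_contra! hlt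
  have hl : 0 < l := hs.trans_lt hlt
  -- If l exceeded the singular value s, then 2l²|x|² ≤ 2 Re (lx)*Mx ≤ l²|x|² + s²|x|² would force l
  -- ≤ s.
  have h4 := two_mul_re_star_dotProduct_le ((l : ℂ) • x) (M *ᵥ x)
  have h5 : nsq ((l : ℂ) • x) = l ^ 2 * nsq x := by
    simp [nsq, Complex.normSq_mul, Finset.mul_sum, sq]
  have h6 : (star ((l : ℂ) • x) ⬝ᵥ M *ᵥ x).re = l * rform M x := by
    simp [rform, star_smul]
  rw [h5, h6] at h4
  have h7 := mul_le_mul_of_nonneg_left h1 hl.le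
  have h8 := mul_lt_mul_of_pos_right (pow_lt_pow_left₀ hlt hs two_ne_zero) (nsq_pos hx)
  nlinarith

/-- The polar decomposition. -/
theorem exists_polar (X : Matrix (Fin n) (Fin n) ℂ) :
    ∃ U : Matrix (Fin n) (Fin n) ℂ, Uᴴ * U = 1 ∧ X = U * CFC.abs X := by
  let E := EuclideanSpace ℂ (Fin n)
  let F : E →ₗ[ℂ] E := toEuclideanLin X
  let G : E →ₗ[ℂ] E := toEuclideanLin (CFC.abs X)
  have hnorm : ∀ v : E, ‖v‖ ^ 2 = nsq v.ofLp := fun v => by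
    rw [EuclideanSpace.norm_sq_eq]
    simp [nsq, Complex.normSq_eq_norm_sq]
  have hFG : ∀ v, ‖F v‖ = ‖G v‖ := fun v => by
    rw [← sq_eq_sq₀ (norm_nonneg _) (norm_nonneg _), hnorm, hnorm]
    exact (nsq_abs_mulVec X v.ofLp).symm
  have hker : LinearMap.ker G ≤ LinearMap.ker F := fun v hv => by
    rw [LinearMap.mem_ker, ← norm_eq_zero, hFG, LinearMap.mem_ker.mp hv, norm_zero]
  obtain ⟨L, hL⟩ := LinearMap.exists_extend
    (((LinearMap.ker G).liftQ F hker).comp G.quotKerEquivRange.symm.toLinearMap)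
  have hLG : ∀ v, L (G v) = F v := fun v => by
    have := LinearMap.congr_fun hL ⟨G v, LinearMap.mem_range_self G v⟩
    have h2 : G.quotKerEquivRange.symm ⟨G v, LinearMap.mem_range_self G v⟩ =
        Submodule.Quotient.mk v := by
      rw [LinearEquiv.symm_apply_eq]
      rfl
    simpa [h2] using this
  -- The map |X|v ↦ Xv is well defined and isometric on the range of |X|; in finite dimension it
  -- extends to an isometry of the whole space.
  let I : LinearMap.range G →ₗᵢ[ℂ] E :=
    { toLinearMap := L.comp (LinearMap.range G).subtype
      norm_map' := by
        rintro ⟨-, v, rfl⟩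
        simp [hLG, hFG] }
  let J : E →ₗᵢ[ℂ] E := I.extend
  have hJ : ∀ v, J (G v) = F v := fun v => by
    have := I.extend_apply ⟨G v, LinearMap.mem_range_self G v⟩
    rw [← hLG v]
    exact this
  let U : Matrix (Fin n) (Fin n) ℂ := toEuclideanLin.symm J.toLinearMap
  have hU : ∀ v : Fin n → ℂ, U *ᵥ v = (J (WithLp.toLp 2 v)).ofLp := fun v => by
    have : toEuclideanLin U = J.toLinearMap := by simp [U]
    have := LinearMap.congr_fun this (WithLp.toLp 2 v)
    simpa using congrArg WithLp.ofLp this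
  refine ⟨U, ?_, ?_⟩
  · have hadj : toEuclideanLin (Uᴴ * U) = LinearMap.id := by
      have hJU : toEuclideanLin U = J.toLinearMap := by simp [U]
      refine LinearMap.ext fun v => ext_inner_right ℂ fun w => ?_
      have h1 : toEuclideanLin (Uᴴ * U) v = toEuclideanLin Uᴴ (toEuclideanLin U v) := by
        simp
      rw [h1, toEuclideanLin_conjTranspose_eq_adjoint, LinearMap.adjoint_inner_left, hJU]
      simp
    apply toEuclideanLin.injective
    rw [hadj]
    ext v : 1
    simp
  · apply ext_of_mulVec_single
    intro i
    rw [← mulVec_mulVec, hU]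
    exact (congrArg WithLp.ofLp (hJ (WithLp.toLp 2 (Pi.single i 1)))).symm

end Eigenvalues

end MatrixMeans

namespace MatrixMeans

open Polynomial Topology

/-! ### Algebra of the holomorphic functional calculus -/

section FunctionalCalculus

variable {n : ℕ} {M : Matrix (Fin n) (Fin n) ℂ}

theorem iteratedDeriv_polynomial_eval (p : ℂ[X]) (k : ℕ) :
    iteratedDeriv k (fun z => p.eval z) = fun z => (derivative^[k] p).eval z := by
  induction k with
  | zero => simp
  | succ k ih =>
    rw [iteratedDeriv_succ, ih, Function.iterate_succ_apply']
    ext z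
    exact Polynomial.deriv _

theorem agreesOnSpectrum_polynomial (p : ℂ[X]) (M : Matrix (Fin n) (Fin n) ℂ) :
    AgreesOnSpectrum p (fun z => p.eval z) M := fun μ _ k _ => by
  rw [iteratedDeriv_polynomial_eval]

theorem matrixFunction_polynomial (p : ℂ[X]) (M : Matrix (Fin n) (Fin n) ℂ) :
    matrixFunction (fun z => p.eval z) M = aeval M p :=
  matrixFunction_eq (agreesOnSpectrum_polynomial p M)

theorem matrixFunction_congr {f g : ℂ → ℂ} (h : ∀ μ ∈ spectrum ℂ M, f =ᶠ[𝓝 μ] g) :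
    matrixFunction f M = matrixFunction g M := by
  obtain ⟨p, hp⟩ := exists_agreesOnSpectrum g M
  rw [matrixFunction_eq hp]
  refine matrixFunction_eq fun μ hμ k hk => ?_
  rw [hp μ hμ k hk, ((h μ hμ).iteratedDeriv k).eq_of_nhds]

/-- By the Leibniz rule, the jet of a product up to a given order depends only on the jets of the
factors up to that order. -/
theorem matrixFunction_mul {f g : ℂ → ℂ} (hf : ∀ μ ∈ spectrum ℂ M, AnalyticAt ℂ f μ)
    (hg : ∀ μ ∈ spectrum ℂ M, AnalyticAt ℂ g μ) :
    matrixFunction (fun z => f z * g z) M = matrixFunction f M * matrixFunction g M := by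
  obtain ⟨p, hp⟩ := exists_agreesOnSpectrum f M
  obtain ⟨q, hq⟩ := exists_agreesOnSpectrum g M
  rw [matrixFunction_eq hp, matrixFunction_eq hq, ← map_mul]
  refine matrixFunction_eq fun μ hμ k hk => ?_
  have h1 : (derivative^[k] (p * q)).eval μ =
      iteratedDeriv k (fun z => p.eval z * q.eval z) μ := by
    simp_rw [← eval_mul]
    rw [iteratedDeriv_polynomial_eval]
  rw [h1, iteratedDeriv_fun_mul (hf μ hμ).contDiffAt (hg μ hμ).contDiffAt,
    iteratedDeriv_fun_mul p.differentiable.contDiff.contDiffAt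
      q.differentiable.contDiff.contDiffAt]
  refine Finset.sum_congr rfl fun i hi => ?_
  rw [iteratedDeriv_polynomial_eval, iteratedDeriv_polynomial_eval]
  have hi' := Finset.mem_range.mp hi
  dsimp only
  rw [hp μ hμ i (by omega), hq μ hμ (k - i) (by omega)]

theorem matrixFunction_one (M : Matrix (Fin n) (Fin n) ℂ) :
    matrixFunction (fun _ => 1) M = 1 := by
  simpa using matrixFunction_polynomial 1 M

theorem matrixFunction_id (M : Matrix (Fin n) (Fin n) ℂ) : matrixFunction (fun z => z) M = M := by
  simpa using matrixFunction_polynomial X M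

theorem matrixFunction_const_add_id (c : ℂ) (M : Matrix (Fin n) (Fin n) ℂ) :
    matrixFunction (fun z => c + z) M = c • 1 + M := by
  have h := matrixFunction_polynomial (C c + X) M
  simp only [eval_add, eval_C, eval_X, map_add, aeval_C, aeval_X] at h
  rw [h, Algebra.algebraMap_eq_smul_one]

/-- `f(M)` is a linear combination of the derivatives of `f` at the eigenvalues of `M`, with
coefficients that do not depend on `f`. -/
theorem exists_jet_expansion (M : Matrix (Fin n) (Fin n) ℂ) :
    ∃ E : ℂ → ℕ → Matrix (Fin n) (Fin n) ℂ, ∀ f : ℂ → ℂ,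
      matrixFunction f M = ∑ μ ∈ (minpoly ℂ M).roots.toFinset,
        ∑ k ∈ Finset.range ((minpoly ℂ M).rootMultiplicity μ), iteratedDeriv k f μ • E μ k := by
  classical
  set S := (minpoly ℂ M).roots.toFinset
  set m : ℂ → ℕ := fun μ => (minpoly ℂ M).rootMultiplicity μ
  -- The Hermite basis: `q μ k` has k-th derivative 1 at `μ`, and every other prescribed derivative
  -- is 0.
  choose q hq using fun (μ : ℂ) (k : ℕ) =>
    exists_hermite S m (fun ν l => if μ = ν ∧ k = l then 1 else 0)
  refine ⟨fun μ k => aeval M (q μ k), fun f => ?_⟩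
  have hS : ∀ μ, 0 < m μ → μ ∈ S := fun μ h => by
    rwa [Multiset.mem_toFinset, ← Multiset.count_pos, count_roots]
  have h : AgreesOnSpectrum (∑ μ ∈ S, ∑ k ∈ Finset.range (m μ), C (iteratedDeriv k f μ) * q μ k)
      f M := by
    intro ν _ l hl
    have hν : ν ∈ S := hS ν (by change 0 < (minpoly ℂ M).rootMultiplicity ν; omega)
    simp only [iterate_derivative_sum, iterate_derivative_C_mul, eval_finsetSum, eval_mul, eval_C]
    rw [Finset.sum_eq_single_of_mem ν hν, Finset.sum_eq_single_of_mem l (Finset.mem_range.mpr hl)]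
    · rw [hq ν l ν hν l hl]
      simp
    · intro k _ hk
      rw [hq ν k ν hν l hl]
      simp [hk]
    · intro μ _ hμ
      refine Finset.sum_eq_zero fun k _ => ?_
      rw [hq μ k ν hν l hl]
      simp [hμ]
  rw [matrixFunction_eq h]
  simp [map_sum, Algebra.smul_def]
  rfl

theorem mem_spectrum_of_mem_roots_minpoly {μ : ℂ} (hμ : μ ∈ (minpoly ℂ M).roots.toFinset) :
    μ ∈ spectrum ℂ M := by
  rw [← AlgEquiv.spectrum_eq (Matrix.toLinAlgEquiv' (R := ℂ) (n := Fin n)) M,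
    ← Module.End.hasEigenvalue_iff_mem_spectrum]
  apply Module.End.hasEigenvalue_of_isRoot
  rw [minpoly.algEquiv_eq]
  exact isRoot_of_mem_roots (Multiset.mem_toFinset.mp hμ)

theorem mpow_mul_mpow (hM : spectrum ℂ M ⊆ Complex.slitPlane) (r s : ℝ) :
    mpow M r * mpow M s = mpow M (r + s) := by
  rw [mpow, mpow, ← matrixFunction_mul]
  · refine matrixFunction_congr fun μ hμ => ?_
    filter_upwards [Complex.isOpen_slitPlane.mem_nhds (hM hμ)] with z hz
    rw [Complex.ofReal_add, Complex.cpow_add _ _ (Complex.slitPlane_ne_zero hz)]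
  · exact fun μ hμ => analyticAt_id.cpow analyticAt_const (hM hμ)
  · exact fun μ hμ => analyticAt_id.cpow analyticAt_const (hM hμ)

theorem mpow_zero (M : Matrix (Fin n) (Fin n) ℂ) : mpow M 0 = 1 := by
  simpa [mpow] using matrixFunction_one M

theorem mpow_one (M : Matrix (Fin n) (Fin n) ℂ) : mpow M 1 = M := by
  simpa [mpow] using matrixFunction_id M

theorem add_ne_zero_of_mem_slitPlane {z : ℂ} (hz : z ∈ Complex.slitPlane) {s : ℝ} (hs : 0 ≤ s) :
    (s : ℂ) + z ≠ 0 := by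
  intro h
  have : z = ((-s : ℝ) : ℂ) := by rw [eq_neg_of_add_eq_zero_right h]; simp
  rw [this, Complex.ofReal_mem_slitPlane] at hz
  linarith

/-- Identifies the integrand of the fractional power as M(s + M)⁻¹, without mentioning an inverse.
-/
theorem matrixFunction_div_add_mul (hM : spectrum ℂ M ⊆ Complex.slitPlane) {s : ℝ} (hs : 0 ≤ s) :
    matrixFunction (fun z => z / (s + z)) M * ((s : ℂ) • 1 + M) = M := by
  rw [← matrixFunction_const_add_id, ← matrixFunction_mul]
  · conv_rhs => rw [← matrixFunction_id M]
    refine matrixFunction_congr fun μ hμ => ?_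
    filter_upwards [Complex.isOpen_slitPlane.mem_nhds (hM hμ)] with z hz
    exact div_mul_cancel₀ _ (add_ne_zero_of_mem_slitPlane hz hs)
  · exact fun μ hμ => analyticAt_id.div (analyticAt_const.add analyticAt_id)
      (add_ne_zero_of_mem_slitPlane (hM hμ) hs)
  · exact fun μ _ => analyticAt_const.add analyticAt_id

end FunctionalCalculus

end MatrixMeans

namespace MatrixMeans

open Set Topology MeasureTheory Real

/-! ### Integral representation of fractional powers -/

section IntegralRepresentation

/-- The `k`-th derivative with respect to `z` of `z / (s + z)`. -/
def fracDeriv (s : ℝ) : ℕ → ℂ → ℂ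
  | 0, z => z / (s + z)
  | k + 1, z => (-1) ^ k * ((k + 1).factorial : ℂ) * s / (s + z) ^ (k + 2)

theorem hasDerivAt_fracDeriv (k : ℕ) {s : ℝ} (hs : 0 ≤ s) {z : ℂ} (hz : z ∈ Complex.slitPlane) :
    HasDerivAt (fracDeriv s k) (fracDeriv s (k + 1) z) z := by
  have hne := add_ne_zero_of_mem_slitPlane hz hs
  have hd : HasDerivAt (fun w : ℂ => (s : ℂ) + w) 1 z := (hasDerivAt_id z).const_add _
  cases k with
  | zero =>
    refine ((hasDerivAt_id z).div hd hne).congr_deriv ?_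
    simp [fracDeriv]
  | succ k =>
    have h := ((hd.pow (k + 2)).inv (pow_ne_zero _ hne)).const_mul
      ((-1) ^ k * ((k + 1).factorial : ℂ) * s)
    refine h.congr_deriv ?_
    simp only [fracDeriv, Nat.factorial_succ, Nat.cast_mul, Pi.pow_apply]
    push_cast
    field_simp
    ring

theorem iteratedDeriv_eq_of_hasDerivAt {U : Set ℂ} (hU : IsOpen U) {H : ℕ → ℂ → ℂ}
    (h : ∀ k, ∀ z ∈ U, HasDerivAt (H k) (H (k + 1) z) z) (k : ℕ) {z : ℂ} (hz : z ∈ U) :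
    iteratedDeriv k (H 0) z = H k z := by
  induction k generalizing z with
  | zero => simp
  | succ k ih =>
    rw [iteratedDeriv_succ, ← (h k z hz).deriv]
    apply Filter.EventuallyEq.deriv_eq
    filter_upwards [hU.mem_nhds hz] with w hw using ih hw

/-- The half-line -s, s ≥ 0, keeps a positive distance from z, and |s + z| grows like s. This gives
the domination needed for differentiating under the integral. -/
theorem exists_mul_le_norm_add {z : ℂ} (hz : z ∈ Complex.slitPlane) :
    ∃ δ : ℝ, 0 < δ ∧ ∀ s : ℝ, 0 ≤ s → δ * (1 + s) ≤ ‖(s : ℂ) + z‖ := by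
  obtain ⟨m, hm, hle⟩ : ∃ m : ℝ, 0 < m ∧ ∀ s : ℝ, 0 ≤ s → m ≤ ‖(s : ℂ) + z‖ := by
    rcases Complex.mem_slitPlane_iff.mp hz with h | h
    · refine ⟨z.re, h, fun s hs => ?_⟩
      have := Complex.re_le_norm ((s : ℂ) + z)
      simp at this
      linarith
    · refine ⟨|z.im|, abs_pos.mpr h, fun s hs => ?_⟩
      simpa using Complex.abs_im_le_norm ((s : ℂ) + z)
  have hz0 := norm_nonneg z
  refine ⟨m / (1 + ‖z‖ + m), by positivity, fun s hs => ?_⟩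
  have h1 : s ≤ ‖(s : ℂ) + z‖ + ‖z‖ := by
    have := norm_sub_le ((s : ℂ) + z) z
    simpa [abs_of_nonneg hs] using this
  have h2 := hle s hs
  rw [div_mul_eq_mul_div, div_le_iff₀ (by positivity)]
  nlinarith

theorem exists_norm_fracDeriv_le (k : ℕ) {z₀ : ℂ} (hz₀ : z₀ ∈ Complex.slitPlane) :
    ∃ ε C : ℝ, 0 < ε ∧ ∀ z ∈ Metric.ball z₀ ε, z ∈ Complex.slitPlane ∧
      ∀ s : ℝ, 0 ≤ s → ‖fracDeriv s k z‖ ≤ C / (1 + s) := by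
  obtain ⟨δ, hδ, hle⟩ := exists_mul_le_norm_add hz₀
  obtain ⟨ε₁, hε₁, hball⟩ := Metric.isOpen_iff.mp Complex.isOpen_slitPlane z₀ hz₀
  have hlow : ∀ z ∈ Metric.ball z₀ (min ε₁ (δ / 2)), ∀ s : ℝ, 0 ≤ s →
      δ / 2 * (1 + s) ≤ ‖(s : ℂ) + z‖ := fun z hz s hs => by
    have h1 : ‖z - z₀‖ < δ / 2 := (mem_ball_iff_norm.mp hz).trans_le (min_le_right _ _)
    have h2 : ‖(s : ℂ) + z₀‖ ≤ ‖(s : ℂ) + z‖ + ‖z - z₀‖ := by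
      have := norm_sub_le ((s : ℂ) + z) (z - z₀)
      rwa [show (s : ℂ) + z - (z - z₀) = s + z₀ by ring] at this
    have := hle s hs
    nlinarith
  have hin : ∀ z ∈ Metric.ball z₀ (min ε₁ (δ / 2)), z ∈ Complex.slitPlane := fun z hz =>
    hball (Metric.ball_subset_ball (min_le_left _ _) hz)
  cases k with
  | zero =>
    refine ⟨min ε₁ (δ / 2), (‖z₀‖ + δ / 2) / (δ / 2), by positivity, fun z hz =>
      ⟨hin z hz, fun s hs => ?_⟩⟩
    have h1 : ‖z‖ ≤ ‖z₀‖ + δ / 2 := by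
      have := norm_add_le z₀ (z - z₀)
      have h2 : ‖z - z₀‖ < δ / 2 := (mem_ball_iff_norm.mp hz).trans_le (min_le_right _ _)
      rw [add_sub_cancel] at this
      linarith
    rw [fracDeriv, norm_div, div_div]
    exact div_le_div₀ (by positivity) h1 (by positivity) (hlow z hz s hs)
  | succ k =>
    refine ⟨min ε₁ (δ / 2), (k + 1).factorial / (δ / 2) ^ (k + 2), by positivity, fun z hz =>
      ⟨hin z hz, fun s hs => ?_⟩⟩
    have h1 : ‖fracDeriv s (k + 1) z‖ = (k + 1).factorial * s / ‖(s : ℂ) + z‖ ^ (k + 2) := by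
      simp [fracDeriv, abs_of_nonneg hs]
    have h2 : (δ / 2 * (1 + s)) ^ (k + 2) ≤ ‖(s : ℂ) + z‖ ^ (k + 2) :=
      pow_le_pow_left₀ (by positivity) (hlow z hz s hs) _
    -- The factor s costs one power of 1 + s; since k + 2 ≥ 2, decay of order 1/(1 + s) remains.
    have h3 : s * (1 + s) ≤ (1 + s) ^ (k + 2) := by
      have : (1 + s) ^ 2 ≤ (1 + s) ^ (k + 2) := pow_le_pow_right₀ (by linarith) (by omega)
      nlinarith
    rw [h1, div_div]
    calc (k + 1).factorial * s / ‖(s : ℂ) + z‖ ^ (k + 2)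
        ≤ (k + 1).factorial * s / (δ / 2 * (1 + s)) ^ (k + 2) := by gcongr
      _ ≤ _ := by
        rw [div_le_div_iff₀ (by positivity) (by positivity), mul_pow]
        calc _ = ((k + 1).factorial * (δ / 2) ^ (k + 2)) * (s * (1 + s)) := by ring
          _ ≤ ((k + 1).factorial * (δ / 2) ^ (k + 2)) * (1 + s) ^ (k + 2) := by gcongr
          _ = _ := by ring

variable {t : ℝ}

theorem integrableOn_rpow_div (ht : t ∈ Ioo (0 : ℝ) 1) :
    IntegrableOn (fun s : ℝ => s ^ (t - 1) / (1 + s)) (Ioi 0) := by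
  refine (integrableOn_rpowIntegrand₀₁_Ioi ht zero_le_one).congr_fun (fun s hs => ?_)
    measurableSet_Ioi
  have h := rpowIntegrand₀₁_eqOn_pow_div ht zero_le_one hs
  dsimp only at h ⊢
  rw [h, mul_one, add_comm]

/-- The normalizing constant `∫₀^∞ s^{t-1} / (1 + s) ds`, that is, `π / sin (π t)`. -/
def rpowConst (t : ℝ) : ℝ := ∫ s in Ioi (0 : ℝ), rpowIntegrand₀₁ t s 1

theorem rpowConst_pos (ht : t ∈ Ioo (0 : ℝ) 1) : 0 < rpowConst t :=
  integral_rpowIntegrand₀₁_one_pos ht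

theorem continuousOn_rpow_mul_fracDeriv (t : ℝ) (k : ℕ) {z : ℂ} (hz : z ∈ Complex.slitPlane) :
    ContinuousOn (fun s : ℝ => ((s ^ (t - 1) : ℝ) : ℂ) * fracDeriv s k z) (Ioi 0) := by
  refine ContinuousOn.mul ?_ ?_
  · exact Complex.continuous_ofReal.comp_continuousOn
      (continuousOn_id.rpow_const fun s hs => Or.inl (ne_of_gt hs))
  · have hne : ∀ s ∈ Ioi (0 : ℝ), (s : ℂ) + z ≠ 0 := fun s hs =>
      add_ne_zero_of_mem_slitPlane hz (le_of_lt hs)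
    have hc : Continuous fun s : ℝ => (s : ℂ) + z := Complex.continuous_ofReal.add continuous_const
    cases k with
    | zero => exact continuousOn_const.div hc.continuousOn hne
    | succ k =>
      exact (continuous_const.mul Complex.continuous_ofReal).continuousOn.div
        (hc.pow _).continuousOn fun s hs => pow_ne_zero _ (hne s hs)

theorem norm_rpow_mul_le {k : ℕ} {C s : ℝ} {z : ℂ} (hs : 0 < s)
    (h : ‖fracDeriv s k z‖ ≤ C / (1 + s)) :
    ‖((s ^ (t - 1) : ℝ) : ℂ) * fracDeriv s k z‖ ≤ C * (s ^ (t - 1) / (1 + s)) := by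
  have h0 : 0 ≤ s ^ (t - 1) := rpow_nonneg hs.le _
  rw [norm_mul, Complex.norm_real, norm_of_nonneg h0]
  calc _ ≤ s ^ (t - 1) * (C / (1 + s)) := by gcongr
    _ = _ := by ring

theorem integrableOn_rpow_mul_fracDeriv (ht : t ∈ Ioo (0 : ℝ) 1) (k : ℕ) {z : ℂ}
    (hz : z ∈ Complex.slitPlane) :
    IntegrableOn (fun s : ℝ => ((s ^ (t - 1) : ℝ) : ℂ) * fracDeriv s k z) (Ioi 0) := by
  obtain ⟨ε, C, hε, h⟩ := exists_norm_fracDeriv_le k hz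
  refine Integrable.mono' ((integrableOn_rpow_div ht).const_mul C)
    ((continuousOn_rpow_mul_fracDeriv t k hz).aestronglyMeasurable measurableSet_Ioi) ?_
  filter_upwards [ae_restrict_mem measurableSet_Ioi] with s hs
  exact norm_rpow_mul_le hs ((h z (Metric.mem_ball_self hε)).2 s (le_of_lt hs))

theorem hasDerivAt_integral_fracDeriv (ht : t ∈ Ioo (0 : ℝ) 1) (k : ℕ) {z : ℂ}
    (hz : z ∈ Complex.slitPlane) :
    HasDerivAt (fun z => ∫ s in Ioi (0 : ℝ), ((s ^ (t - 1) : ℝ) : ℂ) * fracDeriv s k z)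
      (∫ s in Ioi (0 : ℝ), ((s ^ (t - 1) : ℝ) : ℂ) * fracDeriv s (k + 1) z) z := by
  obtain ⟨ε, C, hε, h⟩ := exists_norm_fracDeriv_le (k + 1) hz
  refine (hasDerivAt_integral_of_dominated_loc_of_deriv_le (μ := volume.restrict (Ioi (0 : ℝ)))
    (F := fun z (s : ℝ) => ((s ^ (t - 1) : ℝ) : ℂ) * fracDeriv s k z)
    (F' := fun z (s : ℝ) => ((s ^ (t - 1) : ℝ) : ℂ) * fracDeriv s (k + 1) z)
    (bound := fun s => C * (s ^ (t - 1) / (1 + s)))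
    (Metric.ball_mem_nhds z hε) ?_ (integrableOn_rpow_mul_fracDeriv ht k hz)
    ((continuousOn_rpow_mul_fracDeriv t (k + 1) hz).aestronglyMeasurable measurableSet_Ioi)
    ?_ ((integrableOn_rpow_div ht).const_mul C) ?_).2
  · filter_upwards [Complex.isOpen_slitPlane.mem_nhds hz] with w hw
    exact (continuousOn_rpow_mul_fracDeriv t k hw).aestronglyMeasurable measurableSet_Ioi
  · filter_upwards [ae_restrict_mem measurableSet_Ioi] with s hs w hw
    exact norm_rpow_mul_le hs ((h w hw).2 s (le_of_lt hs))
  · filter_upwards [ae_restrict_mem measurableSet_Ioi] with s hs w hw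
    exact (hasDerivAt_fracDeriv k (le_of_lt hs) (h w hw).1).const_mul _

theorem integral_rpow_mul_div (ht : t ∈ Ioo (0 : ℝ) 1) {x : ℝ} (hx : 0 ≤ x) :
    ∫ s in Ioi (0 : ℝ), s ^ (t - 1) * (x / (s + x)) = x ^ t * rpowConst t := by
  rw [rpowConst, ← integral_rpowIntegrand₀₁_eq_rpow_mul_const ht hx]
  refine setIntegral_congr_fun measurableSet_Ioi fun s hs => ?_
  have h := rpowIntegrand₀₁_eqOn_pow_div ht hx hs
  dsimp only at h ⊢
  rw [h, mul_div_assoc]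

theorem integrableOn_rpow_mul_div (ht : t ∈ Ioo (0 : ℝ) 1) {x : ℝ} (hx : 0 ≤ x) :
    IntegrableOn (fun s : ℝ => s ^ (t - 1) * (x / (s + x))) (Ioi 0) := by
  refine (integrableOn_rpowIntegrand₀₁_Ioi ht hx).congr_fun (fun s hs => ?_) measurableSet_Ioi
  have h := rpowIntegrand₀₁_eqOn_pow_div ht hx hs
  dsimp only at h ⊢
  rw [h, mul_div_assoc]

theorem integral_fracDeriv_zero (ht : t ∈ Ioo (0 : ℝ) 1) :
    EqOn (fun z => ∫ s in Ioi (0 : ℝ), ((s ^ (t - 1) : ℝ) : ℂ) * fracDeriv s 0 z)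
      (fun z => z ^ (t : ℂ) * rpowConst t) Complex.slitPlane := by
  refine AnalyticOnNhd.eqOn_of_preconnected_of_frequently_eq (z₀ := 1) ?_ ?_
    (Complex.starConvex_one_slitPlane.isPathConnected
      Complex.one_mem_slitPlane).isConnected.isPreconnected Complex.one_mem_slitPlane ?_
  · exact DifferentiableOn.analyticOnNhd (fun z hz =>
      (hasDerivAt_integral_fracDeriv ht 0 hz).differentiableAt.differentiableWithinAt)
      Complex.isOpen_slitPlane
  · exact fun z hz => (analyticAt_id.cpow analyticAt_const hz).mul analyticAt_const
  -- Identity theorem: both sides agree at the real points 1 + 1/(m + 1), which accumulate at 1.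
  · have hu : Filter.Tendsto (fun m : ℕ => (1 : ℂ) + 1 / ((m : ℂ) + 1)) Filter.atTop (𝓝[≠] 1) := by
      refine tendsto_nhdsWithin_iff.mpr ⟨?_, Filter.Eventually.of_forall fun m => ?_⟩
      · simpa using tendsto_one_div_add_atTop_nhds_zero_nat.const_add (1 : ℂ)
      · have : (m : ℂ) + 1 ≠ 0 := by exact_mod_cast m.succ_ne_zero
        simp [this]
    refine hu.frequently (Filter.Frequently.of_forall fun m => ?_)
    have hx : (0 : ℝ) ≤ 1 + 1 / ((m : ℝ) + 1) := by positivity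
    have hcast : (1 : ℂ) + 1 / ((m : ℂ) + 1) = ((1 + 1 / ((m : ℝ) + 1) : ℝ) : ℂ) := by
      push_cast; rfl
    rw [hcast]
    have h := congrArg ((↑) : ℝ → ℂ) (integral_rpow_mul_div ht hx)
    rw [← integral_complex_ofReal, Complex.ofReal_mul, Complex.ofReal_cpow hx] at h
    rw [← h]
    refine setIntegral_congr_fun measurableSet_Ioi fun s _ => ?_
    simp [fracDeriv]

/-- The derivatives of the integral representation of `z ^ t`. -/
theorem iteratedDeriv_cpow_mul_rpowConst (ht : t ∈ Ioo (0 : ℝ) 1) (k : ℕ) {z : ℂ}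
    (hz : z ∈ Complex.slitPlane) :
    iteratedDeriv k (fun z : ℂ => z ^ (t : ℂ)) z * rpowConst t =
      ∫ s in Ioi (0 : ℝ), ((s ^ (t - 1) : ℝ) : ℂ) * fracDeriv s k z := by
  rw [← iteratedDeriv_eq_of_hasDerivAt (H := fun k z => ∫ s in Ioi (0 : ℝ),
    ((s ^ (t - 1) : ℝ) : ℂ) * fracDeriv s k z) Complex.isOpen_slitPlane
    (fun k z hz => hasDerivAt_integral_fracDeriv ht k hz) k hz, ← iteratedDeriv_mul_const_field]
  apply Filter.EventuallyEq.eq_of_nhds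
  apply Filter.EventuallyEq.iteratedDeriv
  filter_upwards [Complex.isOpen_slitPlane.mem_nhds hz] with w hw
  exact (integral_fracDeriv_zero ht hw).symm

/-- The integral representation of the fractional powers of a matrix, in weak form. -/
theorem mpow_integral {n : ℕ} {M : Matrix (Fin n) (Fin n) ℂ}
    (hM : spectrum ℂ M ⊆ Complex.slitPlane) (ht : t ∈ Ioo (0 : ℝ) 1)
    (l : Matrix (Fin n) (Fin n) ℂ →ₗ[ℂ] ℂ) :
    IntegrableOn (fun s : ℝ => s ^ (t - 1) * (l (matrixFunction (fun z => z / (s + z)) M)).re)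
      (Ioi 0) ∧
    ∫ s in Ioi (0 : ℝ), s ^ (t - 1) * (l (matrixFunction (fun z => z / (s + z)) M)).re =
      (l (mpow M t)).re * rpowConst t := by
  obtain ⟨E, hE⟩ := exists_jet_expansion M
  set S := (minpoly ℂ M).roots.toFinset
  have hS : ∀ μ ∈ S, μ ∈ Complex.slitPlane := fun μ hμ =>
    hM (mem_spectrum_of_mem_roots_minpoly hμ)
  -- The jet coefficients `E` serve every s and also z^t, so the matrix integral reduces to finitely
  -- many scalar ones, even for non-diagonalizable `M`.
  have h1 : EqOn (fun s : ℝ => ∑ μ ∈ S, ∑ k ∈ Finset.range ((minpoly ℂ M).rootMultiplicity μ),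
        ((s ^ (t - 1) : ℝ) : ℂ) * fracDeriv s k μ * l (E μ k))
      (fun s : ℝ => ((s ^ (t - 1) : ℝ) : ℂ) * l (matrixFunction (fun z => z / (s + z)) M))
      (Ioi 0) := fun s hs => by
    dsimp only
    rw [hE, map_sum, Finset.mul_sum]
    refine Finset.sum_congr rfl fun μ hμ => ?_
    rw [map_sum, Finset.mul_sum]
    refine Finset.sum_congr rfl fun k _ => ?_
    rw [map_smul, smul_eq_mul, mul_assoc]
    congr 2
    exact (iteratedDeriv_eq_of_hasDerivAt Complex.isOpen_slitPlane
      (fun k z hz => hasDerivAt_fracDeriv k (le_of_lt hs) hz) k (hS μ hμ)).symm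
  have hint : ∀ μ ∈ S, ∀ k, IntegrableOn (fun s : ℝ =>
      ((s ^ (t - 1) : ℝ) : ℂ) * fracDeriv s k μ * l (E μ k)) (Ioi 0) := fun μ hμ k =>
    (integrableOn_rpow_mul_fracDeriv ht k (hS μ hμ)).mul_const _
  have h2 : IntegrableOn (fun s : ℝ => ((s ^ (t - 1) : ℝ) : ℂ) *
      l (matrixFunction (fun z => z / (s + z)) M)) (Ioi 0) := by
    refine IntegrableOn.congr_fun ?_ h1 measurableSet_Ioi
    exact integrable_finsetSum _ fun μ hμ => integrable_finsetSum _ fun k _ => hint μ hμ k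
  have h3 : ∫ s in Ioi (0 : ℝ), ((s ^ (t - 1) : ℝ) : ℂ) *
      l (matrixFunction (fun z => z / (s + z)) M) = l (mpow M t) * rpowConst t := by
    rw [← setIntegral_congr_fun measurableSet_Ioi h1, integral_finsetSum _ fun μ hμ =>
      integrable_finsetSum _ fun k _ => hint μ hμ k, mpow, hE, map_sum, Finset.sum_mul]
    refine Finset.sum_congr rfl fun μ hμ => ?_
    rw [integral_finsetSum _ fun k _ => hint μ hμ k, map_sum, Finset.sum_mul]
    refine Finset.sum_congr rfl fun k _ => ?_
    rw [integral_mul_const, ← iteratedDeriv_cpow_mul_rpowConst ht k (hS μ hμ), map_smul,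
      smul_eq_mul]
    ring
  have h4 : (fun s : ℝ => s ^ (t - 1) * (l (matrixFunction (fun z => z / (s + z)) M)).re) =
      fun s : ℝ => RCLike.re (((s ^ (t - 1) : ℝ) : ℂ) *
        l (matrixFunction (fun z => z / (s + z)) M)) := by
    ext s
    simp
  rw [h4]
  refine ⟨h2.re, ?_⟩
  rw [integral_re h2, h3]
  simp

end IntegralRepresentation

end MatrixMeans

namespace MatrixMeans

open Matrix Set MeasureTheory

variable {n : ℕ}

/-! ### Accretivity, the APT condition and simultaneous diagonalization -/

section Accretive

theorem IsStrictlyAccretive.rform_pos {M : Matrix (Fin n) (Fin n) ℂ} (hM : IsStrictlyAccretive M)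
    {x : Fin n → ℂ} (hx : x ≠ 0) : 0 < rform M x := by
  rw [← rform_realPart]
  exact posDef_rform_pos hM hx

theorem exists_mulVec_eq_of_rform_pos {M : Matrix (Fin n) (Fin n) ℂ}
    (hM : ∀ x : Fin n → ℂ, x ≠ 0 → 0 < rform M x) (y : Fin n → ℂ) : ∃ x, M *ᵥ x = y := by
  have hinj : Function.Injective M.mulVecLin := by
    rw [← LinearMap.ker_eq_bot, Submodule.eq_bot_iff]
    intro x hx
    by_contra hx0
    have h := hM x hx0
    rw [rform, show M *ᵥ x = 0 from hx] at h
    simp at h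
  exact LinearMap.injective_iff_surjective.mp hinj y

theorem exists_mulVec_eq_smul {M : Matrix (Fin n) (Fin n) ℂ} {μ : ℂ} (hμ : μ ∈ spectrum ℂ M) :
    ∃ v : Fin n → ℂ, v ≠ 0 ∧ M *ᵥ v = μ • v := by
  rw [← AlgEquiv.spectrum_eq (Matrix.toLinAlgEquiv' (R := ℂ) (n := Fin n)) M,
    ← Module.End.hasEigenvalue_iff_mem_spectrum] at hμ
  obtain ⟨v, hv⟩ := hμ.exists_hasEigenvector
  exact ⟨v, hv.2, by simpa using hv.apply_eq_smul⟩

theorem IsStrictlyAccretive.spectrum_subset {M : Matrix (Fin n) (Fin n) ℂ}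
    (hM : IsStrictlyAccretive M) : spectrum ℂ M ⊆ Complex.slitPlane := by
  intro μ hμ
  obtain ⟨v, hv, h⟩ := exists_mulVec_eq_smul hμ
  have h1 := hM.rform_pos hv
  have h2 : (star v ⬝ᵥ v).im = 0 := (Complex.nonneg_iff.mp (dotProduct_star_self_nonneg v)).2.symm
  rw [rform, h, dotProduct_smul, smul_eq_mul, Complex.mul_re, h2, star_dotProduct_self_re,
    mul_zero, sub_zero] at h1
  exact Complex.mem_slitPlane_iff.mpr (Or.inl (pos_of_mul_pos_left h1 (nsq_nonneg v)))

theorem rform_fromBlocks_neg (M X N : Matrix (Fin n) (Fin n) ℂ) (u v : Fin n → ℂ) :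
    rform (fromBlocks M X Xᴴ N) (Sum.elim u (-v)) =
      rform M u + rform N v - 2 * (star u ⬝ᵥ X *ᵥ v).re := by
  have hstar : star (Sum.elim u (-v)) = Sum.elim (star u) (-star v) := by
    ext i
    cases i <;> simp
  have h : (star v ⬝ᵥ Xᴴ *ᵥ u).re = (star u ⬝ᵥ X *ᵥ v).re := by
    rw [star_dotProduct_mulVec, conjTranspose_conjTranspose, re_star_dotProduct_comm]
  rw [rform, hstar, fromBlocks_mulVec, sumElim_dotProduct_sumElim]
  simp [rform, mulVec_neg, h]
  ring

theorem IsAPT.two_mul_re_le {A B X : Matrix (Fin n) (Fin n) ℂ}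
    (hM : IsAPT (fromBlocks A X Xᴴ B)) (u v : Fin n → ℂ) :
    2 * (star u ⬝ᵥ X *ᵥ v).re ≤ rform A u + rform B v ∧
      2 * (star u ⬝ᵥ X *ᵥ v).re ≤ rform B u + rform A v := by
  constructor
  · have h := posSemidef_rform_nonneg hM.1 (Sum.elim u (-v))
    rw [rform_realPart, rform_fromBlocks_neg] at h
    linarith
  -- The partial transpose has X* in the upper corner, so the two vectors exchange places.
  · have h := posSemidef_rform_nonneg hM.2 (Sum.elim v (-u))
    have h1 : partialTranspose (fromBlocks A X Xᴴ B) = fromBlocks A Xᴴ Xᴴᴴ B := by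
      simp [partialTranspose]
    rw [rform_realPart, h1, rform_fromBlocks_neg, star_dotProduct_mulVec,
      conjTranspose_conjTranspose, re_star_dotProduct_comm] at h
    linarith

/-- Simultaneous diagonalization of two positive definite forms by a congruence. -/
theorem exists_congruence_diagonal {P Q : Matrix (Fin n) (Fin n) ℂ} (hP : P.PosDef)
    (hQ : Q.PosDef) :
    ∃ (S : Matrix (Fin n) (Fin n) ℂ) (d : Fin n → ℝ), IsUnit S ∧ (∀ i, 0 < d i) ∧
      (∀ x, rform P x = nsq (Sᴴ *ᵥ x)) ∧
      ∀ x, rform Q x = ∑ i, d i * Complex.normSq ((Sᴴ *ᵥ x) i) := by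
  obtain ⟨R, hR⟩ : ∃ R : Matrix (Fin n) (Fin n) ℂ, P = Rᴴ * R :=
    CStarAlgebra.nonneg_iff_eq_star_mul_self.mp hP.posSemidef.nonneg
  have hRu : IsUnit R := by
    have := hP.isUnit
    rw [isUnit_iff_isUnit_det, hR, det_mul] at this
    exact (isUnit_iff_isUnit_det _).mpr (isUnit_of_mul_isUnit_right this)
  have hRdet := (isUnit_iff_isUnit_det R).mp hRu
  have hRR : R⁻¹ * R = 1 := nonsing_inv_mul R hRdet
  have hRR' : Rᴴ * R⁻¹ᴴ = 1 := by
    rw [← conjTranspose_mul, hRR, conjTranspose_one]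
  have hQ' : (R⁻¹ᴴ * Q * R⁻¹).IsHermitian := isHermitian_conjTranspose_mul_mul _ hQ.isHermitian
  obtain ⟨V, hV, hV', hQV⟩ := exists_unitary_diagonal_lam hQ'
  set d := lam (R⁻¹ᴴ * Q * R⁻¹) hQ'
  have hVu : IsUnit V := IsUnit.of_mul_eq_one _ hV'
  have hSu : IsUnit (Rᴴ * V) := (hRu.star).mul hVu
  have hPS : ∀ x, rform P x = nsq ((Rᴴ * V)ᴴ *ᵥ x) := fun x => by
    rw [nsq_mulVec, conjTranspose_conjTranspose, conjTranspose_mul, conjTranspose_conjTranspose,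
      Matrix.mul_assoc, ← Matrix.mul_assoc V, hV', Matrix.one_mul, hR]
  have hQS : ∀ x, rform Q x = ∑ i, d i * Complex.normSq (((Rᴴ * V)ᴴ *ᵥ x) i) := fun x => by
    rw [← rform_diagonal, ← rform_conj]
    congr 1
    calc Q = (Rᴴ * R⁻¹ᴴ) * Q * (R⁻¹ * R) := by rw [hRR, hRR', Matrix.one_mul, Matrix.mul_one]
      _ = Rᴴ * (R⁻¹ᴴ * Q * R⁻¹) * R := by simp only [Matrix.mul_assoc]
      _ = _ := by rw [hQV]; simp only [conjTranspose_mul, conjTranspose_conjTranspose,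
          Matrix.mul_assoc]
  -- Positivity of `d i` is read off by testing the form of `Q` at the vector that S* sends to the
  -- i-th basis vector.
  refine ⟨Rᴴ * V, d, hSu, fun i => ?_, hPS, hQS⟩
  obtain ⟨x, hx⟩ := (mulVec_surjective_iff_isUnit.mpr hSu.star) (Pi.single i 1)
  have hx0 : x ≠ 0 := by
    rintro rfl
    have := congrFun hx i
    simp at this
  have h := posDef_rform_pos hQ hx0
  rw [hQS x, show (Rᴴ * V)ᴴ *ᵥ x = Pi.single i 1 from hx] at h
  rw [Finset.sum_eq_single_of_mem i (Finset.mem_univ i)] at h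
  · simpa using h
  · intro k _ hk
    simp [hk]

end Accretive

/-! ### Interpolation in diagonal coordinates -/

section Interpolation

variable {t : ℝ} {d : Fin n → ℝ}

theorem integral_sum_rpow (ht : t ∈ Ioo (0 : ℝ) 1) (hd : ∀ i, 0 < d i) (ξ : Fin n → ℝ) :
    IntegrableOn (fun s : ℝ => s ^ (t - 1) * ∑ i, ξ i * (d i / (s + d i))) (Ioi 0) ∧
    ∫ s in Ioi (0 : ℝ), s ^ (t - 1) * ∑ i, ξ i * (d i / (s + d i)) =
      (∑ i, d i ^ t * ξ i) * rpowConst t := by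
  have h : (fun s : ℝ => s ^ (t - 1) * ∑ i, ξ i * (d i / (s + d i))) =
      fun s : ℝ => ∑ i, ξ i * (s ^ (t - 1) * (d i / (s + d i))) := by
    ext s
    rw [Finset.mul_sum]
    exact Finset.sum_congr rfl fun i _ => by ring
  have hi : ∀ i, IntegrableOn (fun s : ℝ => ξ i * (s ^ (t - 1) * (d i / (s + d i)))) (Ioi 0) :=
    fun i => (integrableOn_rpow_mul_div ht (hd i).le).const_mul _
  rw [h]
  refine ⟨integrable_finsetSum _ fun i _ => hi i, ?_⟩
  rw [integral_finsetSum _ fun i _ => hi i, Finset.sum_mul]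
  refine Finset.sum_congr rfl fun i _ => ?_
  rw [integral_const_mul, integral_rpow_mul_div ht (hd i).le]
  ring

theorem sum_rpow_mul_le (ht : t ∈ Ioo (0 : ℝ) 1) (hd : ∀ i, 0 < d i) (ξ : Fin n → ℝ)
    {g : ℝ → ℝ} {G : ℝ} (hg : IntegrableOn (fun s : ℝ => s ^ (t - 1) * g s) (Ioi 0))
    (hG : ∫ s in Ioi (0 : ℝ), s ^ (t - 1) * g s = G * rpowConst t)
    (h : ∀ s : ℝ, 0 < s → ∑ i, ξ i * (d i / (s + d i)) ≤ g s) :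
    ∑ i, d i ^ t * ξ i ≤ G := by
  obtain ⟨h1, h2⟩ := integral_sum_rpow ht hd ξ
  refine le_of_mul_le_mul_right ?_ (rpowConst_pos ht)
  rw [← h2, ← hG]
  exact setIntegral_mono_on h1 hg measurableSet_Ioi fun s hs =>
    mul_le_mul_of_nonneg_left (h s hs) (Real.rpow_nonneg (le_of_lt hs) _)

/-- Joint convexity of |z|²/p, the pointwise inequality behind both comparisons of integrands. -/
theorem normSq_add_div_le (a b : ℂ) {p q : ℝ} (hp : 0 < p) (hq : 0 < q) :
    Complex.normSq (a + b) / (p + q) ≤ Complex.normSq a / p + Complex.normSq b / q := by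
  rw [div_add_div _ _ hp.ne' hq.ne', div_le_div_iff₀ (by positivity) (by positivity)]
  simp only [Complex.normSq_apply, Complex.add_re, Complex.add_im]
  nlinarith [sq_nonneg (q * a.re - p * b.re), sq_nonneg (q * a.im - p * b.im)]

/-- The hypotheses amount to Y D⁻¹ Y* ≤ 1 (take b = D⁻¹Y*a) and Y Y* ≤ D (take b = Y*a). These are
the endpoints t = 0 and t = 1 of Y D^(t-1) Y* ≤ D^t. -/
theorem sum_rpow_conjTranspose_mulVec_le (ht : t ∈ Icc (0 : ℝ) 1) (hd : ∀ i, 0 < d i)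
    {Y : Matrix (Fin n) (Fin n) ℂ}
    (h1 : ∀ a b : Fin n → ℂ, 2 * (star a ⬝ᵥ Y *ᵥ b).re ≤
      nsq a + ∑ i, d i * Complex.normSq (b i))
    (h2 : ∀ a b : Fin n → ℂ, 2 * (star a ⬝ᵥ Y *ᵥ b).re ≤
      (∑ i, d i * Complex.normSq (a i)) + nsq b) (a : Fin n → ℂ) :
    ∑ i, d i ^ t * (Complex.normSq ((Yᴴ *ᵥ a) i) / d i) ≤
      ∑ i, d i ^ t * Complex.normSq (a i) := by
  have k1 : ∀ a : Fin n → ℂ, ∑ i, Complex.normSq ((Yᴴ *ᵥ a) i) / d i ≤ nsq a := fun a => by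
    have h := h1 a fun i => (Yᴴ *ᵥ a) i / d i
    rw [star_dotProduct_mulVec] at h
    have e1 : (star (Yᴴ *ᵥ a) ⬝ᵥ fun i => (Yᴴ *ᵥ a) i / d i).re =
        ∑ i, Complex.normSq ((Yᴴ *ᵥ a) i) / d i := by
      rw [dotProduct, Complex.re_sum]
      refine Finset.sum_congr rfl fun i _ => ?_
      rw [Pi.star_apply, RCLike.star_def, mul_div_assoc', ← Complex.normSq_eq_conj_mul_self,
        ← Complex.ofReal_div, Complex.ofReal_re]
    have e2 : ∑ i, d i * Complex.normSq ((Yᴴ *ᵥ a) i / d i) =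
        ∑ i, Complex.normSq ((Yᴴ *ᵥ a) i) / d i := by
      refine Finset.sum_congr rfl fun i _ => ?_
      have := (hd i).ne'
      rw [Complex.normSq_div, Complex.normSq_ofReal]
      field_simp
    rw [e1, e2] at h
    linarith
  have k2 : ∀ a : Fin n → ℂ, nsq (Yᴴ *ᵥ a) ≤ ∑ i, d i * Complex.normSq (a i) := fun a => by
    have h := h2 a (Yᴴ *ᵥ a)
    rw [star_dotProduct_mulVec, star_dotProduct_self_re] at h
    linarith
  rcases eq_or_lt_of_le ht.1 with rfl | ht0
  · simpa [nsq] using k1 a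
  rcases eq_or_lt_of_le ht.2 with rfl | ht1
  · refine le_trans (le_of_eq ?_) ((k2 a).trans (le_of_eq ?_))
    · refine Finset.sum_congr rfl fun i _ => ?_
      rw [Real.rpow_one, mul_div_cancel₀ _ (hd i).ne']
    · simp
  obtain ⟨hg, hG⟩ := integral_sum_rpow ⟨ht0, ht1⟩ hd fun i => Complex.normSq (a i)
  refine sum_rpow_mul_le ⟨ht0, ht1⟩ hd _ hg hG fun s hs => ?_
  -- The splitting a = y + z that minimizes |y|² + z*Dz/s; the minimum is the integrand on the
  -- right.
  set y : Fin n → ℂ := fun i => ((d i / (s + d i) : ℝ) : ℂ) * a i with hy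
  set z : Fin n → ℂ := fun i => ((s / (s + d i) : ℝ) : ℂ) * a i with hz
  have hyz : a = y + z := by
    ext i
    have : s + d i ≠ 0 := (add_pos hs (hd i)).ne'
    rw [Pi.add_apply, hy, hz, ← add_mul, ← Complex.ofReal_add, ← add_div, add_comm (d i),
      div_self this, Complex.ofReal_one, one_mul]
  calc ∑ i, Complex.normSq ((Yᴴ *ᵥ a) i) / d i * (d i / (s + d i))
      = ∑ i, Complex.normSq ((Yᴴ *ᵥ y) i + (Yᴴ *ᵥ z) i) / (d i + s) := by
        refine Finset.sum_congr rfl fun i _ => ?_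
        have := (hd i).ne'
        have h3 : s + d i ≠ 0 := (add_pos hs (hd i)).ne'
        have h4 : d i + s ≠ 0 := (add_pos (hd i) hs).ne'
        rw [← Pi.add_apply, ← mulVec_add, ← hyz, add_comm (d i)]
        field_simp
    _ ≤ ∑ i, (Complex.normSq ((Yᴴ *ᵥ y) i) / d i + Complex.normSq ((Yᴴ *ᵥ z) i) / s) :=
        Finset.sum_le_sum fun i _ => normSq_add_div_le _ _ (hd i) hs
    _ = (∑ i, Complex.normSq ((Yᴴ *ᵥ y) i) / d i) + nsq (Yᴴ *ᵥ z) / s := by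
        rw [Finset.sum_add_distrib, nsq, Finset.sum_div]
    _ ≤ nsq y + (∑ i, d i * Complex.normSq (z i)) / s :=
        add_le_add (k1 y) (div_le_div_of_nonneg_right (k2 z) hs.le)
    _ = ∑ i, Complex.normSq (a i) * (d i / (s + d i)) := by
        rw [nsq, Finset.sum_div, ← Finset.sum_add_distrib]
        refine Finset.sum_congr rfl fun i _ => ?_
        have h3 : s + d i ≠ 0 := (add_pos hs (hd i)).ne'
        have h4 := hs.ne'
        simp only [hy, hz, Complex.normSq_mul, Complex.normSq_ofReal]
        field_simp
        ring

/-- Weighted AM–GM on the pairing of Y*a with b, with weights d_i^(t-1), followed by the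
interpolated bound on Y*a. -/
theorem two_mul_re_le_sum_rpow (ht : t ∈ Icc (0 : ℝ) 1) (hd : ∀ i, 0 < d i)
    {Y : Matrix (Fin n) (Fin n) ℂ}
    (h1 : ∀ a b : Fin n → ℂ, 2 * (star a ⬝ᵥ Y *ᵥ b).re ≤
      nsq a + ∑ i, d i * Complex.normSq (b i))
    (h2 : ∀ a b : Fin n → ℂ, 2 * (star a ⬝ᵥ Y *ᵥ b).re ≤
      (∑ i, d i * Complex.normSq (a i)) + nsq b) (a b : Fin n → ℂ) :
    2 * (star a ⬝ᵥ Y *ᵥ b).re ≤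
      (∑ i, d i ^ t * Complex.normSq (a i)) + ∑ i, d i ^ (1 - t) * Complex.normSq (b i) := by
  refine le_trans ?_ (add_le_add_left (sum_rpow_conjTranspose_mulVec_le ht hd h1 h2 a) _)
  rw [star_dotProduct_mulVec, dotProduct, Complex.re_sum, Finset.mul_sum,
    ← Finset.sum_add_distrib]
  refine Finset.sum_le_sum fun i _ => ?_
  set c := (Yᴴ *ᵥ a) i
  have hw : 0 < d i ^ t / d i := div_pos (Real.rpow_pos_of_pos (hd i) t) (hd i)
  have hw' : d i ^ (1 - t) = (d i ^ t / d i)⁻¹ := by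
    rw [Real.rpow_sub (hd i), Real.rpow_one, inv_div]
  rw [hw', ← mul_div_assoc, mul_div_right_comm]
  set w := d i ^ t / d i
  have h3 : (star (Yᴴ *ᵥ a) i * b i).re = c.re * (b i).re + c.im * (b i).im := by
    simp [c, Complex.mul_re]
  have h4 : w * Complex.normSq c + w⁻¹ * Complex.normSq (b i) -
      2 * (c.re * (b i).re + c.im * (b i).im) =
      w⁻¹ * ((w * c.re - (b i).re) ^ 2 + (w * c.im - (b i).im) ^ 2) := by
    simp only [Complex.normSq_apply]
    field_simp
    ring
  have h5 : 0 ≤ w⁻¹ * ((w * c.re - (b i).re) ^ 2 + (w * c.im - (b i).im) ^ 2) := by positivity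
  rw [h3]
  linarith

end Interpolation

/-! ### The geometric mean of strictly accretive matrices -/

section GeometricMean

variable {A B : Matrix (Fin n) (Fin n) ℂ}

theorem IsStrictlyAccretive.mpow_half_mul (hA : IsStrictlyAccretive A) :
    mpow A (1 / 2) * mpow A (1 / 2) = A ∧ mpow A (1 / 2) * mpow A (-(1 / 2)) = 1 ∧
      mpow A (-(1 / 2)) * mpow A (1 / 2) = 1 := by
  have h := hA.spectrum_subset
  rw [mpow_mul_mpow h, mpow_mul_mpow h, mpow_mul_mpow h]
  norm_num [mpow_zero, mpow_one]

theorem geomMean_zero (hA : IsStrictlyAccretive A) (B : Matrix (Fin n) (Fin n) ℂ) :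
    geomMean 0 A B = A := by
  rw [geomMean, mpow_zero, Matrix.mul_one, hA.mpow_half_mul.1]

theorem geomMean_one (hA : IsStrictlyAccretive A) (B : Matrix (Fin n) (Fin n) ℂ) :
    geomMean 1 A B = B := by
  obtain ⟨-, h1, h2⟩ := hA.mpow_half_mul
  rw [geomMean, mpow_one]
  calc _ = (mpow A (1 / 2) * mpow A (-(1 / 2))) * B * (mpow A (-(1 / 2)) * mpow A (1 / 2)) := by
        simp only [Matrix.mul_assoc]
    _ = B := by rw [h1, h2, Matrix.one_mul, Matrix.mul_one]

/-- An eigenvalue μ ≤ 0 would give Bw = μAw for some w ≠ 0, hence B[w] = μA[w] ≤ 0. -/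
theorem spectrum_conj_subset (hA : IsStrictlyAccretive A) (hB : IsStrictlyAccretive B) :
    spectrum ℂ (mpow A (-(1 / 2)) * B * mpow A (-(1 / 2))) ⊆ Complex.slitPlane := by
  intro μ hμ
  obtain ⟨hHH, hHK, hKH⟩ := hA.mpow_half_mul
  set H := mpow A (1 / 2)
  set K := mpow A (-(1 / 2))
  obtain ⟨v, hv, h⟩ := exists_mulVec_eq_smul hμ
  by_contra hs
  rw [Complex.mem_slitPlane_iff, not_or, not_lt, not_not] at hs
  have hμr : μ = (μ.re : ℂ) := Complex.ext rfl (by simp [hs.2])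
  have hHw : H *ᵥ (K *ᵥ v) = v := by rw [mulVec_mulVec, hHK, one_mulVec]
  have hw : K *ᵥ v ≠ 0 := fun h0 => hv (by rw [← hHw, h0, mulVec_zero])
  have hBw : B *ᵥ (K *ᵥ v) = (μ.re : ℂ) • A *ᵥ (K *ᵥ v) := by
    calc B *ᵥ (K *ᵥ v) = (H * K) *ᵥ (B *ᵥ (K *ᵥ v)) := by rw [hHK, one_mulVec]
      _ = H *ᵥ ((K * B * K) *ᵥ v) := by simp only [mulVec_mulVec, Matrix.mul_assoc]
      _ = (μ.re : ℂ) • H *ᵥ v := by rw [h, mulVec_smul, ← hμr]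
      _ = _ := by rw [← hHH, ← mulVec_mulVec, hHw]
  have h1 := hB.rform_pos hw
  have h2 := hA.rform_pos hw
  rw [rform, hBw, dotProduct_smul, smul_eq_mul, Complex.re_ofReal_mul] at h1
  exact absurd h1 (not_lt.mpr (mul_nonpos_of_nonpos_of_nonneg hs.1 h2.le))

/-- The integrand of the geometric mean is the parallel sum of `A` and `s⁻¹ B`. -/
theorem exists_rform_parallelSum (hA : IsStrictlyAccretive A) (hB : IsStrictlyAccretive B)
    {s : ℝ} (hs : 0 < s) (x : Fin n → ℂ) :
    ∃ y w : Fin n → ℂ, x = y + (s : ℂ) • w ∧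
      rform (mpow A (1 / 2) * matrixFunction (fun z => z / (s + z))
        (mpow A (-(1 / 2)) * B * mpow A (-(1 / 2))) * mpow A (1 / 2)) x =
        rform A y + s * rform B w := by
  have hF := matrixFunction_div_add_mul (spectrum_conj_subset hA hB) hs.le
  obtain ⟨hHH, hHK, hKH⟩ := hA.mpow_half_mul
  set H := mpow A (1 / 2)
  set K := mpow A (-(1 / 2))
  set F := matrixFunction (fun z => z / (s + z)) (K * B * K)
  have hpos : ∀ x : Fin n → ℂ, x ≠ 0 → 0 < rform (s • A + B) x := fun x hx => by
    rw [rform_add, rform_smul]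
    exact add_pos (mul_pos hs (hA.rform_pos hx)) (hB.rform_pos hx)
  -- With w = (sA + B)⁻¹Ax, the integrand sends x to Bw, while y = x - sw satisfies Ay = Bw; thus
  -- x*Bw = y*Ay + s w*Bw.
  obtain ⟨w, hw⟩ := exists_mulVec_eq_of_rform_pos hpos (A *ᵥ x)
  have hsum : (s : ℂ) • 1 + K * B * K = K * (s • A + B) * K := by
    have h1 : K * A * K = 1 := by
      rw [← hHH]
      calc K * (H * H) * K = (K * H) * (H * K) := by simp only [Matrix.mul_assoc]
        _ = 1 := by rw [hKH, hHK, Matrix.one_mul]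
    rw [Matrix.mul_add, Matrix.add_mul, Matrix.mul_smul, Matrix.smul_mul, h1]
    rfl
  have hFK : F * K * (s • A + B) = K * B := by
    calc F * K * (s • A + B) = F * (K * (s • A + B) * K) * H := by
          simp only [Matrix.mul_assoc, hKH, Matrix.mul_one]
      _ = K * B := by
          rw [← hsum, hF, Matrix.mul_assoc, hKH, Matrix.mul_one]
  have hx : (H * F * H) *ᵥ x = B *ᵥ w := by
    calc (H * F * H) *ᵥ x = (H * F * K) *ᵥ (A *ᵥ x) := by
          rw [← hHH, mulVec_mulVec]
          congr 1
          calc H * F * H = H * F * (K * H) * H := by rw [hKH, Matrix.mul_one]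
            _ = _ := by simp only [Matrix.mul_assoc]
      _ = (H * (F * K * (s • A + B))) *ᵥ w := by
          rw [← hw, mulVec_mulVec]
          simp only [Matrix.mul_assoc]
      _ = B *ᵥ w := by rw [hFK, ← Matrix.mul_assoc, hHK, Matrix.one_mul]
  refine ⟨x - (s : ℂ) • w, w, by simp, ?_⟩
  have hy : A *ᵥ (x - (s : ℂ) • w) = B *ᵥ w := by
    rw [mulVec_sub, ← hw, mulVec_smul, add_mulVec, smul_mulVec]
    exact add_sub_cancel_left _ _
  rw [rform, hx, rform, hy, rform]
  simp

/-- The left side is the form of Re A ♯ₜ Re B. The integrand on the right equals A[y] + s B[w] for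
one splitting x = y + sw; the integrand on the left is a lower bound over all splittings. -/
theorem sum_rpow_le_rform_geomMean (hA : IsStrictlyAccretive A) (hB : IsStrictlyAccretive B)
    {S : Matrix (Fin n) (Fin n) ℂ} {d : Fin n → ℝ} (hd : ∀ i, 0 < d i)
    (hAS : ∀ x, rform A x = nsq (Sᴴ *ᵥ x))
    (hBS : ∀ x, rform B x = ∑ i, d i * Complex.normSq ((Sᴴ *ᵥ x) i))
    {t : ℝ} (ht : t ∈ Icc (0 : ℝ) 1) (x : Fin n → ℂ) :
    ∑ i, d i ^ t * Complex.normSq ((Sᴴ *ᵥ x) i) ≤ rform (geomMean t A B) x := by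
  rcases eq_or_lt_of_le ht.1 with rfl | ht0
  · rw [geomMean_zero hA, hAS]
    simp [nsq]
  rcases eq_or_lt_of_le ht.2 with rfl | ht1
  · rw [geomMean_one hA, hBS]
    simp
  let l : Matrix (Fin n) (Fin n) ℂ →ₗ[ℂ] ℂ :=
    { toFun := fun F => star x ⬝ᵥ (mpow A (1 / 2) * F * mpow A (1 / 2)) *ᵥ x
      map_add' := fun F G => by
        rw [Matrix.mul_add, Matrix.add_mul, add_mulVec, dotProduct_add]
      map_smul' := fun c F => by
        rw [Matrix.mul_smul, Matrix.smul_mul, smul_mulVec, dotProduct_smul, RingHom.id_apply] }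
  obtain ⟨hg, hG⟩ := mpow_integral (spectrum_conj_subset hA hB) ⟨ht0, ht1⟩ l
  refine sum_rpow_mul_le ⟨ht0, ht1⟩ hd _ hg hG fun s hs => ?_
  obtain ⟨y, w, hx, h⟩ := exists_rform_parallelSum hA hB hs x
  refine le_trans ?_ (le_of_eq h.symm)
  rw [hAS, hBS, nsq, Finset.mul_sum, ← Finset.sum_add_distrib]
  refine Finset.sum_le_sum fun i _ => ?_
  have hxi : (Sᴴ *ᵥ x) i = (Sᴴ *ᵥ y) i + s * (Sᴴ *ᵥ w) i := by
    rw [hx, mulVec_add, mulVec_smul]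
    simp
  have h1 := normSq_add_div_le ((Sᴴ *ᵥ y) i) (s * (Sᴴ *ᵥ w) i) one_pos (div_pos hs (hd i))
  rw [← hxi, Complex.normSq_mul, Complex.normSq_ofReal] at h1
  have hd' := (hd i).ne'
  have hs' := hs.ne'
  have h2 : s + d i ≠ 0 := (add_pos hs (hd i)).ne'
  have h3 : 1 + s / d i = (s + d i) / d i := by field_simp; ring
  have h4 : s * s * Complex.normSq ((Sᴴ *ᵥ w) i) / (s / d i) =
      s * (d i * Complex.normSq ((Sᴴ *ᵥ w) i)) := by field_simp
  rw [h3, h4, div_one, div_div_eq_mul_div, mul_div_assoc] at h1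
  exact h1

theorem two_mul_re_le_rform_geomMean {X : Matrix (Fin n) (Fin n) ℂ} (hA : IsStrictlyAccretive A)
    (hB : IsStrictlyAccretive B) (hM : IsAPT (fromBlocks A X Xᴴ B)) {t : ℝ}
    (ht : t ∈ Icc (0 : ℝ) 1) (u v : Fin n → ℂ) :
    2 * (star u ⬝ᵥ X *ᵥ v).re ≤ rform (geomMean t A B) u + rform (geomMean (1 - t) A B) v := by
  obtain ⟨S, d, hS, hd, hAS, hBS⟩ := exists_congruence_diagonal hA hB
  simp only [rform_realPart] at hAS hBS
  have hdet := (isUnit_iff_isUnit_det S).mp hS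
  have hSS : ∀ a, Sᴴ *ᵥ (S⁻¹ᴴ *ᵥ a) = a := fun a => by
    rw [mulVec_mulVec, ← conjTranspose_mul, nonsing_inv_mul S hdet, conjTranspose_one, one_mulVec]
  have hSS' : ∀ a, S⁻¹ᴴ *ᵥ (Sᴴ *ᵥ a) = a := fun a => by
    rw [mulVec_mulVec, ← conjTranspose_mul, mul_nonsing_inv S hdet, conjTranspose_one, one_mulVec]
  have hY : ∀ a b : Fin n → ℂ, star a ⬝ᵥ (S⁻¹ * X * S⁻¹ᴴ) *ᵥ b =
      star (S⁻¹ᴴ *ᵥ a) ⬝ᵥ X *ᵥ (S⁻¹ᴴ *ᵥ b) := fun a b => by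
    rw [← mulVec_mulVec, ← mulVec_mulVec, star_dotProduct_mulVec]
  have h := two_mul_re_le_sum_rpow ht hd (Y := S⁻¹ * X * S⁻¹ᴴ)
    (fun a b => by
      have := (hM.two_mul_re_le (S⁻¹ᴴ *ᵥ a) (S⁻¹ᴴ *ᵥ b)).1
      rwa [hAS, hBS, hSS, hSS, ← hY] at this)
    (fun a b => by
      have := (hM.two_mul_re_le (S⁻¹ᴴ *ᵥ a) (S⁻¹ᴴ *ᵥ b)).2
      rwa [hAS, hBS, hSS, hSS, ← hY] at this) (Sᴴ *ᵥ u) (Sᴴ *ᵥ v)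
  rw [hY, hSS', hSS'] at h
  have ht' : 1 - t ∈ Icc (0 : ℝ) 1 := ⟨by linarith [ht.2], by linarith [ht.1]⟩
  exact h.trans (add_le_add (sum_rpow_le_rform_geomMean hA hB hd hAS hBS ht u)
    (sum_rpow_le_rform_geomMean hA hB hd hAS hBS ht' v))

end GeometricMean

end MatrixMeans

end

theorem mainTheorem10 (n : ℕ) (A B X : Matrix (Fin n) (Fin n) ℂ)
    (hA : MatrixMeans.IsStrictlyAccretive A) (hB : MatrixMeans.IsStrictlyAccretive B)
    (hM : MatrixMeans.IsAPT (Matrix.fromBlocks A X Xᴴ B))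
    (t : ℝ) (ht : t ∈ Set.Icc (0 : ℝ) 1) (j : Fin n) :
    MatrixMeans.lam
        ((2 : ℝ) • CFC.abs X - (ℜ (MatrixMeans.geomMean t A B) : Matrix (Fin n) (Fin n) ℂ))
        (MatrixMeans.isHermitian_two_abs_sub X (MatrixMeans.geomMean t A B)) j
      ≤ MatrixMeans.lam
        (ℜ (MatrixMeans.geomMean (1 - t) A B) : Matrix (Fin n) (Fin n) ℂ)
        (MatrixMeans.isHermitian_realPart (MatrixMeans.geomMean (1 - t) A B)) j ∧
    MatrixMeans.lam
        (ℜ (MatrixMeans.geomMean (1 - t) A B) : Matrix (Fin n) (Fin n) ℂ)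
        (MatrixMeans.isHermitian_realPart (MatrixMeans.geomMean (1 - t) A B)) j
      ≤ MatrixMeans.sval (MatrixMeans.geomMean (1 - t) A B) j := by
  refine ⟨?_, MatrixMeans.lam_realPart_le_sval _ j⟩
  obtain ⟨U, hU, hX⟩ := MatrixMeans.exists_polar X
  refine MatrixMeans.lam_le_lam_of_rform_le _ _ hU (fun x => ?_) j
  have ht' : 1 - t ∈ Set.Icc (0 : ℝ) 1 := ⟨by linarith [ht.2], by linarith [ht.1]⟩
  -- The weight 1 - t goes with Ux, so that the rotated mean is the one on the right of the claim.
  have h := MatrixMeans.two_mul_re_le_rform_geomMean hA hB hM ht' (U.mulVec x) x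
  have hUX : Uᴴ * X = CFC.abs X := by
    conv_lhs => rw [hX, ← Matrix.mul_assoc, hU, Matrix.one_mul]
  have hre : (star (U.mulVec x) ⬝ᵥ X.mulVec x).re = MatrixMeans.rform (CFC.abs X) x := by
    rw [MatrixMeans.rform, ← hUX, ← Matrix.mulVec_mulVec,
      MatrixMeans.star_dotProduct_mulVec Uᴴ, Matrix.conjTranspose_conjTranspose]
  rw [sub_sub_cancel, hre] at h
  rw [MatrixMeans.rform_sub, MatrixMeans.rform_smul, MatrixMeans.rform_realPart,
    MatrixMeans.rform_realPart]
  linarith
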